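/- Let $\mathcal H$ be a separable complex Hilbert space and let $T$ be a bounded linear operator on $\mathcal H$. A conjugation on a complex Hilbert space is a conjugate-linear isometric map $C$ with $C^2=I$, and a bounded operator $S$ is called complex symmetric if there is a conjugation $C$ on its space with $S = C S^* C$. The operator $T$ is called an indestructible complex symmetric operator if, for every separable complex Hilbert space $\mathcal K$ and every bounded linear operator $B$ on $\mathcal K$, the operator $T\otimes B$ on the Hilbert space tensor product $\mathcal H\otimes\mathcal K$ is complex symmetric. Then $T$ is an indestructible complex symmetric operator if and only if $T$ is nilpotent of order at most two, that is, $T^2=0$. -/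

import Mathlib

open scoped TensorProduct InnerProductSpace

universe u v

noncomputable section

/-- A conjugation on a complex Hilbert space: a conjugate-linear isometry whose square is the
identity. -/
def IsConjugation {H : Type*} [NormedAddCommGroup H] [InnerProductSpace ℂ H]
    (C : H →ₗᵢ⋆[ℂ] H) : Prop :=
  ∀ x, C (C x) = x

/-- `T` is complex symmetric if `T = C T* C` for some conjugation `C`. -/
def IsComplexSymmetric {H : Type*} [NormedAddCommGroup H] [InnerProductSpace ℂ H]
    [CompleteSpace H] (T : H →L[ℂ] H) : Prop :=
  ∃ C : H →ₗᵢ⋆[ℂ] H, IsConjugation C ∧ ∀ x, T x = C (ContinuousLinearMap.adjoint T (C x))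

/-- The Hilbert space tensor product: the completion of the algebraic tensor product with respect
to the inner product determined by `⟪x ⊗ y, x' ⊗ y'⟫ = ⟪x, x'⟫ * ⟪y, y'⟫`. -/
abbrev HilbertTensor (H K : Type*) [NormedAddCommGroup H] [InnerProductSpace ℂ H]
    [NormedAddCommGroup K] [InnerProductSpace ℂ K] : Type _ :=
  UniformSpace.Completion (H ⊗[ℂ] K)

/-- The bounded operator `A ⊗ B` on the Hilbert space tensor product: the continuous extension of
the operator with `x ⊗ y ↦ A x ⊗ B y` on the algebraic tensor product. -/
def hilbertTensorMap {H K : Type*} [NormedAddCommGroup H] [InnerProductSpace ℂ H]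
    [NormedAddCommGroup K] [InnerProductSpace ℂ K] (A : H →L[ℂ] H) (B : K →L[ℂ] K) :
    HilbertTensor H K →L[ℂ] HilbertTensor H K :=
  (TensorProduct.mapL A B).completion

/-- `A` is an indestructible complex symmetric operator if `A ⊗ B` is complex symmetric for every
bounded operator `B` on every separable complex Hilbert space `K`. The universe `v` of `K` is
independent of the universe of `H`. -/
def IsIndestructibleComplexSymmetric {H : Type u} [NormedAddCommGroup H]
    [InnerProductSpace ℂ H] (A : H →L[ℂ] H) : Prop :=
  ∀ (K : Type v) [NormedAddCommGroup K] [InnerProductSpace ℂ K] [CompleteSpace K]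
    [TopologicalSpace.SeparableSpace K] (B : K →L[ℂ] K),
    IsComplexSymmetric (hilbertTensorMap A B)

end

open ContinuousLinearMap UniformSpace

/-! ### Multiplicativity, norm and adjoint of `A ⊗ B`. -/

section Tensor

variable {H K : Type*} [NormedAddCommGroup H] [InnerProductSpace ℂ H]
  [NormedAddCommGroup K] [InnerProductSpace ℂ K]

/-! Necessity: a conjugation witnessing complex symmetry exchanges `A` and `A*`, so `A*A²` and
`AA*²` have equal norm. For `T ⊗ B` both norms factor; comparing `B` with `B*`, where `B` is a
weighted shift violating the equality, forces `T*T² = 0`, hence `T² = 0` (`norm_adjoint_mul_sq`,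
`exists_norm_adjoint_mul_sq_lt`). Sufficiency: `T² = 0` gives `(T ⊗ B)² = 0`, and every square-zero
`N` is complex symmetric. On `(ker N)ᗮ` write `N = V S` with `S` self-adjoint and `V` an isometry
into `ker N`. In a basis `b` making `S` real symmetric, swapping `b i` with `V (b i)` and
conjugating coordinates gives the conjugation. -/

theorem hilbertTensorMap_coe (A : H →L[ℂ] H) (B : K →L[ℂ] K) (x : H ⊗[ℂ] K) :
    hilbertTensorMap A B (x : HilbertTensor H K) = (TensorProduct.mapL A B x : H ⊗[ℂ] K) :=
  completion_apply_coe _ _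

theorem hilbertTensorMap_mul (A A' : H →L[ℂ] H) (B B' : K →L[ℂ] K) :
    hilbertTensorMap (A * A') (B * B') = hilbertTensorMap A B * hilbertTensorMap A' B' := by
  ext x
  induction x using Completion.induction_on with
  | hp => exact isClosed_eq (by fun_prop) (by fun_prop)
  | ih x =>
    rw [mul_apply_eq_comp, hilbertTensorMap_coe, hilbertTensorMap_coe, hilbertTensorMap_coe,
      TensorProduct.mapL_mul, mul_apply_eq_comp]

theorem hilbertTensorMap_zero_left (B : K →L[ℂ] K) :
    hilbertTensorMap (0 : H →L[ℂ] H) B = 0 := by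
  ext x
  induction x using Completion.induction_on with
  | hp => exact isClosed_eq (by fun_prop) (by fun_prop)
  | ih x => simp [hilbertTensorMap_coe]

theorem norm_hilbertTensorMap (A : H →L[ℂ] H) (B : K →L[ℂ] K) :
    ‖hilbertTensorMap A B‖ = ‖A‖ * ‖B‖ := by
  apply le_antisymm
  · refine opNorm_le_bound _ (by positivity) fun x => ?_
    induction x using Completion.induction_on with
    | hp => exact isClosed_le (by fun_prop) (by fun_prop)
    | ih x =>
      rw [hilbertTensorMap_coe, Completion.norm_coe, Completion.norm_coe]
      exact ((TensorProduct.mapL A B).le_opNorm x).trans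
        (mul_le_mul_of_nonneg_right (TensorProduct.norm_mapL_le A B) (norm_nonneg _))
  · have key : ∀ x y, ‖A x‖ * ‖B y‖ ≤ ‖hilbertTensorMap A B‖ * ‖x‖ * ‖y‖ := fun x y => by
      have h := (hilbertTensorMap A B).le_opNorm ((x ⊗ₜ[ℂ] y : H ⊗[ℂ] K) : HilbertTensor H K)
      rwa [hilbertTensorMap_coe, Completion.norm_coe, Completion.norm_coe,
        TensorProduct.mapL_tmul, TensorProduct.norm_tmul, TensorProduct.norm_tmul,
        ← mul_assoc] at h
    have hB : ∀ x, ‖A x‖ * ‖B‖ ≤ ‖hilbertTensorMap A B‖ * ‖x‖ := fun x => by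
      have : ‖(‖A x‖ : ℂ) • B‖ ≤ ‖hilbertTensorMap A B‖ * ‖x‖ :=
        opNorm_le_bound _ (by positivity) fun y => by
          simpa [norm_smul] using key x y
      simpa [norm_smul] using this
    have : ‖(‖B‖ : ℂ) • A‖ ≤ ‖hilbertTensorMap A B‖ :=
      opNorm_le_bound _ (by positivity) fun x => by
        simpa [norm_smul, mul_comm] using hB x
    simpa [norm_smul, mul_comm] using this

theorem adjoint_hilbertTensorMap [CompleteSpace H] [CompleteSpace K] (A : H →L[ℂ] H)
    (B : K →L[ℂ] K) : adjoint (hilbertTensorMap A B) = hilbertTensorMap (adjoint A) (adjoint B) := by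
  symm
  rw [eq_adjoint_iff]
  intro x y
  induction x, y using Completion.induction_on₂ with
  | hp => exact isClosed_eq (by fun_prop) (by fun_prop)
  | ih x y =>
    rw [hilbertTensorMap_coe, hilbertTensorMap_coe, Completion.inner_coe, Completion.inner_coe]
    induction x using TensorProduct.induction_on with
    | zero => simp
    | add x x' hx hx' => simp only [map_add, inner_add_left, hx, hx']
    | tmul a b =>
      induction y using TensorProduct.induction_on with
      | zero => simp
      | add y y' hy hy' => simp only [map_add, inner_add_right, hy, hy']
      | tmul c d => simp [adjoint_inner_left]

end Tensor

/-! ### Necessity: a norm identity and a shift violating it. -/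

section NormIdentity

variable {H : Type*} [NormedAddCommGroup H] [InnerProductSpace ℂ H] [CompleteSpace H]

theorem IsComplexSymmetric.norm_adjoint_mul_sq {A : H →L[ℂ] H} (hA : IsComplexSymmetric A) :
    ‖adjoint A * A ^ 2‖ = ‖A * adjoint A ^ 2‖ := by
  obtain ⟨C, hC, h⟩ := hA
  have h₁ : ∀ x, C (A x) = adjoint A (C x) := fun x => by rw [h, hC]
  have h₂ : ∀ x, C (adjoint A x) = A (C x) := fun x => by rw [h, hC]
  apply le_antisymm
  · refine opNorm_le_bound _ (by positivity) fun x => ?_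
    have hx := (A * adjoint A ^ 2).le_opNorm (C x)
    simp only [pow_two, mul_apply_eq_comp] at hx ⊢
    rwa [← h₁, ← h₁, ← h₂, C.norm_map, C.norm_map] at hx
  · refine opNorm_le_bound _ (by positivity) fun x => ?_
    have hx := (adjoint A * A ^ 2).le_opNorm (C x)
    simp only [pow_two, mul_apply_eq_comp] at hx ⊢
    rwa [← h₂, ← h₂, ← h₁, C.norm_map, C.norm_map] at hx

/-- The range of `A` meets the kernel of `A*` only in zero. -/
theorem sq_eq_zero_of_adjoint_mul_sq_eq_zero {A : H →L[ℂ] H} (hA : adjoint A * A ^ 2 = 0) :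
    A ^ 2 = 0 := by
  ext x
  have hx : adjoint A (A (A x)) = 0 := by simpa [pow_two] using congr($hA x)
  rw [pow_two, mul_apply_eq_comp, zero_apply, ← inner_self_eq_zero (𝕜 := ℂ),
    ← adjoint_inner_left, hx, inner_zero_left]

/-- A weighted shift on a three-dimensional space with distinct weights. -/
theorem exists_norm_adjoint_mul_sq_lt : ∃ B : EuclideanSpace ℂ (ULift.{v} (Fin 3)) →L[ℂ]
    EuclideanSpace ℂ (ULift.{v} (Fin 3)), ‖B * adjoint B ^ 2‖ < ‖adjoint B * B ^ 2‖ := by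
  let e : Fin 3 → EuclideanSpace ℂ (ULift.{v} (Fin 3)) := fun i => EuclideanSpace.single ⟨i⟩ 1
  have he : ∀ i j, ⟪e i, e j⟫_ℂ = if i = j then 1 else 0 := fun i j => by
    simp [e, EuclideanSpace.inner_single_left]
  have hn : ∀ i, ‖e i‖ = 1 := fun i => by simp [e]
  clear_value e
  let R := fun i j => InnerProductSpace.rankOne ℂ (e i) (e j)
  have hR : ∀ i j k l, R i j * R k l = if j = k then R i l else 0 := fun i j k l => by
    ext x : 1
    by_cases h : j = k <;> simp [R, he, h, hn]
  have hadj : ∀ i j, adjoint (R i j) = R j i := fun i j => InnerProductSpace.adjoint_rankOne _ _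
  have hRn : ∀ i j, ‖R i j‖ = 1 := fun i j => by simp [R, hn]
  clear_value R
  -- Weights 1 and 2: the two words have norms 4 and 2.
  let B := R 1 0 + (2 : ℂ) • R 2 1
  have hB : adjoint B = R 0 1 + (2 : ℂ) • R 1 2 := by
    simp only [B, map_add, map_smulₛₗ, hadj, Complex.conj_ofNat]
  refine ⟨B, ?_⟩
  have h₁ : adjoint B * B ^ 2 = (4 : ℂ) • R 1 0 := by
    rw [hB]
    simp only [B, pow_two, mul_add, add_mul, smul_mul_assoc, mul_smul_comm, hR, Fin.reduceEq,
      if_true, if_false, smul_zero, add_zero, zero_add, smul_smul]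
    norm_num
  have h₂ : B * adjoint B ^ 2 = (2 : ℂ) • R 1 2 := by
    rw [hB]
    simp only [B, pow_two, mul_add, add_mul, smul_mul_assoc, mul_smul_comm, hR, Fin.reduceEq,
      if_true, if_false, smul_zero, add_zero, zero_add]
  rw [h₁, h₂, norm_smul, norm_smul, hRn, hRn]
  norm_num

theorem IsIndestructibleComplexSymmetric.sq_eq_zero {T : H →L[ℂ] H}
    (hT : IsIndestructibleComplexSymmetric.{_, v} T) : T ^ 2 = 0 := by
  have key : ∀ B : EuclideanSpace ℂ (ULift.{v} (Fin 3)) →L[ℂ] EuclideanSpace ℂ (ULift.{v} (Fin 3)),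
      ‖adjoint T * T ^ 2‖ * ‖adjoint B * B ^ 2‖ = ‖T * adjoint T ^ 2‖ * ‖B * adjoint B ^ 2‖ :=
    fun B => by
      have h := (hT _ B).norm_adjoint_mul_sq
      rw [adjoint_hilbertTensorMap] at h
      simp only [pow_two, ← hilbertTensorMap_mul, norm_hilbertTensorMap] at h ⊢
      exact h
  obtain ⟨B, hB⟩ := exists_norm_adjoint_mul_sq_lt.{v}
  have h₁ := key B
  -- Passing to the adjoint exchanges `p` and `q`; adding both identities gives `a = b`.
  have h₂ := key (adjoint B)
  rw [adjoint_adjoint] at h₂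
  have hq := norm_nonneg (B * adjoint B ^ 2)
  refine sq_eq_zero_of_adjoint_mul_sq_eq_zero (norm_eq_zero.mp ?_)
  generalize ‖adjoint T * T ^ 2‖ = a at *
  generalize ‖T * adjoint T ^ 2‖ = b at *
  generalize ‖adjoint B * B ^ 2‖ = p at *
  generalize ‖B * adjoint B ^ 2‖ = q at *
  have : a * (p + q) = b * (p + q) := by linear_combination h₁ + h₂
  have hab : a = b := mul_right_cancel₀ (by linarith : 0 < p + q).ne' this
  subst hab
  by_contra ha
  exact hB.ne' (mul_left_cancel₀ ha h₁)

end NormIdentity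

/-! ### Conjugations from bases, and real matrices of self-adjoint operators. -/

section Nilpotent

variable {E : Type u} [NormedAddCommGroup E] [InnerProductSpace ℂ E]

theorem HilbertBasis.eq_of_inner_eq {ι : Type*} (b : HilbertBasis ι ℂ E) {x y : E}
    (h : ∀ i, ⟪b i, x⟫_ℂ = ⟪b i, y⟫_ℂ) : x = y := by
  apply b.repr.injective
  ext i
  simpa [b.repr_apply_apply] using h i

theorem im_inner_eq_zero_of_mem_span {s : Set E} (hs : ∀ x ∈ s, ∀ y ∈ s, (⟪x, y⟫_ℂ).im = 0)
    {x y : E} (hx : x ∈ Submodule.span ℝ s) (hy : y ∈ Submodule.span ℝ s) :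
    (⟪x, y⟫_ℂ).im = 0 := by
  induction hx, hy using Submodule.span_induction₂ with
  | mem_mem x y hx hy => exact hs x hx y hy
  | zero_left => simp
  | zero_right => simp
  | add_left x y z _ _ _ hx hy => simp [hx, hy]
  | add_right x y z _ _ _ hx hy => simp [hx, hy]
  | smul_left a x y _ _ h => simp [← Complex.coe_smul, h]
  | smul_right a x y _ _ h => simp [← Complex.coe_smul, h]

theorem HilbertBasis.inner_map_eq_zero {ι F : Type*} [NormedAddCommGroup F]
    [InnerProductSpace ℂ F] (b : HilbertBasis ι ℂ E) (f : E →L[ℂ] F) {z : F}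
    (h : ∀ i, ⟪z, f (b i)⟫_ℂ = 0) (x : E) : ⟪z, f x⟫_ℂ = 0 := by
  suffices h : (innerSL ℂ z).comp f = 0 from congr($h x)
  refine ContinuousLinearMap.ext_on
    (Submodule.dense_iff_topologicalClosure_eq_top.mpr b.dense_span) ?_
  rintro _ ⟨i, rfl⟩
  exact h i

variable [CompleteSpace E]

/-- An operator is complex symmetric if, up to an involution of the indices, its matrix in some
Hilbert basis is symmetric. -/
theorem isComplexSymmetric_of_hilbertBasis {ι : Type*} (b : HilbertBasis ι ℂ E) (σ : ι → ι)
    (hσ : Function.Involutive σ) {T : E →L[ℂ] E}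
    (hT : ∀ i j, ⟪b i, T (b j)⟫_ℂ = ⟪b (σ j), T (b (σ i))⟫_ℂ) : IsComplexSymmetric T := by
  classical
  have hbσ : Orthonormal ℂ (b ∘ σ) := b.orthonormal.comp σ hσ.injective
  let c : HilbertBasis ι ℂ E := HilbertBasis.mk hbσ (by
    rw [Set.range_comp, hσ.surjective.range_eq, Set.image_univ, b.dense_span])
  have hc : ∀ i, c i = b (σ i) := fun i => by simp [c]
  -- Conjugate the coordinates and permute the basis by `σ`.
  let C : E →ₗᵢ⋆[ℂ] E :=
    { toFun := fun x => b.repr.symm (star (c.repr x))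
      map_add' := fun x y => by simp
      map_smul' := fun r x => by simp [star_smul]
      norm_map' := fun x => by simp }
  have hCb : ∀ i x, ⟪b i, C x⟫_ℂ = ⟪x, b (σ i)⟫_ℂ := fun i x => by
    rw [← b.repr_apply_apply]
    change b.repr (b.repr.symm _) i = _
    rw [LinearIsometryEquiv.apply_symm_apply, lp.star_apply, c.repr_apply_apply, hc]
    exact inner_conj_symm _ _
  have hCC : ∀ i, C (b i) = b (σ i) := fun i => b.eq_of_inner_eq fun j => by
    rw [hCb, orthonormal_iff_ite.mp b.orthonormal, orthonormal_iff_ite.mp b.orthonormal]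
    exact if_congr ⟨by rintro rfl; exact (hσ _).symm, by rintro rfl; exact (hσ _).symm⟩ rfl rfl
  refine ⟨C, fun x => b.eq_of_inner_eq fun i => ?_, fun x => ?_⟩
  · rw [hCb, ← inner_conj_symm, hCb, hσ, inner_conj_symm]
  · let C' : E →L⋆[ℂ] E := C.toContinuousLinearMap
    suffices h : T = C'.comp ((adjoint T).comp C') from congr($h x)
    refine ContinuousLinearMap.ext_on
      (Submodule.dense_iff_topologicalClosure_eq_top.mpr b.dense_span) ?_
    rintro _ ⟨j, rfl⟩
    refine b.eq_of_inner_eq fun i => ?_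
    change _ = ⟪b i, C (adjoint T (C (b j)))⟫_ℂ
    rw [hCb, hCC, adjoint_inner_left, hT]

/-- Every self-adjoint operator has a real matrix in some Hilbert basis. -/
theorem IsSelfAdjoint.exists_hilbertBasis_im_inner_eq_zero {S : E →L[ℂ] E}
    (hS : IsSelfAdjoint S) :
    ∃ (ι : Type u) (b : HilbertBasis ι ℂ E), ∀ i j, (⟪b i, S (b j)⟫_ℂ).im = 0 := by
  have hsymm : ∀ x y, ⟪S x, y⟫_ℂ = ⟪x, S y⟫_ℂ := fun x y => by
    conv_lhs => rw [← hS.adjoint_eq, adjoint_inner_left]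
  -- Zorn on `S`-invariant real subspaces with real inner products; a real basis of a maximal one is
  -- a complex basis of `E`.
  let P : Set (Submodule ℝ E) :=
    {R | (∀ x ∈ R, S x ∈ R) ∧ ∀ x ∈ R, ∀ y ∈ R, (⟪x, y⟫_ℂ).im = 0}
  obtain ⟨R, hR⟩ : ∃ R, Maximal (· ∈ P) R := by
    refine zorn_le₀ P fun c hc hchain => ?_
    rcases c.eq_empty_or_nonempty with rfl | hne
    · exact ⟨⊥, by simp [P], by simp⟩
    refine ⟨sSup c, ⟨fun x hx => ?_, fun x hx y hy => ?_⟩, fun z hz => le_sSup hz⟩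
    · rw [Submodule.mem_sSup_of_directed hne hchain.directedOn] at hx ⊢
      obtain ⟨Q, hQ, hx⟩ := hx
      exact ⟨Q, hQ, (hc hQ).1 x hx⟩
    · rw [Submodule.mem_sSup_of_directed hne hchain.directedOn] at hx hy
      obtain ⟨Q, hQ, hx⟩ := hx
      obtain ⟨Q', hQ', hy⟩ := hy
      obtain ⟨M, hM, h, h'⟩ := hchain.directedOn Q hQ Q' hQ'
      exact (hc hM).2 x (h hx) y (h' hy)
  have hinv := hR.prop.1
  have him := hR.prop.2
  have hclosed : IsClosed (R : Set E) := by
    have hmem : R.topologicalClosure ∈ P := by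
      refine ⟨fun x hx => ?_, fun x hx y hy => ?_⟩
      · exact map_mem_closure S.continuous hx hinv
      · have h₁ : ∀ x ∈ R, ∀ y ∈ closure (R : Set E), (⟪x, y⟫_ℂ).im = 0 := fun x hx y hy =>
          closure_minimal (t := {y | (⟪x, y⟫_ℂ).im = 0}) (fun y hy => him x hx y hy)
            (isClosed_eq (by fun_prop) continuous_const) hy
        exact closure_minimal (t := {x | (⟪x, y⟫_ℂ).im = 0}) (fun x hx => h₁ x hx y hy)
          (isClosed_eq (by fun_prop) continuous_const) hx
    rw [hR.eq_of_le hmem R.le_topologicalClosure]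
    exact R.isClosed_topologicalClosure
  have htotal : ∀ e : E, (∀ x ∈ R, ⟪x, e⟫_ℂ = 0) → e = 0 := fun e he => by
    have hpow : ∀ n x y, ⟪(S ^ n) x, y⟫_ℂ = ⟪x, (S ^ n) y⟫_ℂ := fun n => by
      induction n with
      | zero => simp
      | succ n ih =>
        intro x y
        rw [pow_succ, mul_apply_eq_comp, ih, hsymm, ← mul_apply_eq_comp, ← pow_succ', pow_succ]
    have hpowR : ∀ n, ∀ x ∈ R, (S ^ n) x ∈ R := fun n => by
      induction n with
      | zero => simp
      | succ n ih =>
        intro x hx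
        rw [pow_succ, mul_apply_eq_comp]
        exact ih _ (hinv x hx)
    -- The orbit of `e` can be adjoined: `⟪Sⁿe, Sᵐe⟫` depends only on `n + m`, hence is real, and
    -- the orbit is orthogonal to `R`.
    let s : Set E := R ∪ Set.range fun n : ℕ => (S ^ n) e
    have hs : Submodule.span ℝ s ∈ P := by
      refine ⟨fun x hx => ?_, fun x hx y hy => im_inner_eq_zero_of_mem_span ?_ hx hy⟩
      · induction hx using Submodule.span_induction with
        | mem x hx =>
          rcases hx with hx | ⟨n, rfl⟩
          · exact Submodule.subset_span (Or.inl (hinv x hx))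
          · exact Submodule.subset_span (Or.inr ⟨n + 1, by simp [pow_succ']⟩)
        | zero => simp
        | add x y _ _ hx hy => simpa using add_mem hx hy
        | smul a x _ hx =>
          rw [← Complex.coe_smul, map_smul, Complex.coe_smul]
          exact Submodule.smul_mem _ _ hx
      · rintro x (hx | ⟨n, rfl⟩) y (hy | ⟨m, rfl⟩)
        · exact him x hx y hy
        · dsimp only
          rw [← hpow, he _ (hpowR m x hx), Complex.zero_im]
        · dsimp only
          rw [hpow, ← inner_conj_symm, he _ (hpowR n y hy), map_zero, Complex.zero_im]
        · dsimp only
          rw [← Complex.conj_eq_iff_im, inner_conj_symm, hpow, hpow, ← mul_apply_eq_comp,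
            ← mul_apply_eq_comp, ← pow_add, ← pow_add, add_comm]
    have heR : e ∈ R := by
      rw [hR.eq_of_le hs fun x hx => Submodule.subset_span (Or.inl hx)]
      exact Submodule.subset_span (Or.inr ⟨0, by simp⟩)
    exact inner_self_eq_zero.mp (he e heR)
  let _ : InnerProductSpace ℝ E := InnerProductSpace.rclikeToReal ℂ E
  have : CompleteSpace R := hclosed.completeSpace_coe
  obtain ⟨w, b, -⟩ := exists_hilbertBasis ℝ R
  have hre : ∀ x ∈ R, ∀ y ∈ R, ⟪x, y⟫_ℂ = (⟪x, y⟫_ℝ : ℝ) := fun x hx y hy =>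
    Complex.ext rfl (him x hx y hy)
  have hb : Orthonormal ℂ fun i => (b i : E) := by
    classical
    rw [orthonormal_iff_ite]
    intro i j
    rw [hre _ (b i).2 _ (b j).2, ← Submodule.coe_inner, orthonormal_iff_ite.mp b.orthonormal]
    split_ifs <;> simp
  refine ⟨w, HilbertBasis.mkOfOrthogonalEqBot hb ?_, fun i j => ?_⟩
  · rw [Submodule.eq_bot_iff]
    intro e he
    refine htotal e fun x hx => ?_
    have hd : (⟨x, hx⟩ : R) ∈ closure (Submodule.span ℝ (Set.range b) : Set R) := by
      rw [← Submodule.topologicalClosure_coe, b.dense_span]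
      trivial
    refine closure_minimal (t := {x : R | ⟪(x : E), e⟫_ℂ = 0}) (fun y hy => ?_)
      (isClosed_eq (by fun_prop) continuous_const) hd
    change ⟪(y : E), e⟫_ℂ = 0
    induction hy using Submodule.span_induction with
    | mem y hy =>
      obtain ⟨i, rfl⟩ := hy
      exact he _ (Submodule.subset_span ⟨i, rfl⟩)
    | zero => simp
    | add y z _ _ hy hz => simp [hy, hz]
    | smul a y _ hy => simp [← Complex.coe_smul, hy]
  · rw [HilbertBasis.coe_mkOfOrthogonalEqBot]
    exact him _ (b i).2 _ (hinv _ (b j).2)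

end Nilpotent

/-! ### Square-zero operators are complex symmetric. -/

section SquareZero

variable {E : Type u} [NormedAddCommGroup E] [InnerProductSpace ℂ E] [CompleteSpace E]

theorem inner_cfcAbs_apply (N : E →L[ℂ] E) (x y : E) :
    ⟪CFC.abs N x, CFC.abs N y⟫_ℂ = ⟪N x, N y⟫_ℂ := by
  have hsa : adjoint (CFC.abs N) = CFC.abs N := (CFC.abs_nonneg N).isSelfAdjoint.adjoint_eq
  have h : CFC.abs N (CFC.abs N y) = adjoint N (N y) := congr($(CFC.abs_mul_abs N) y)
  rw [← adjoint_inner_right, hsa, h, adjoint_inner_right]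

/-- Polar decomposition on the orthogonal complement of the kernel. -/
theorem exists_linearIsometry_comp_eq (N : E →L[ℂ] E) :
    ∃ (S : N.kerᗮ →L[ℂ] N.kerᗮ) (V : N.kerᗮ →ₗᵢ[ℂ] E), IsSelfAdjoint S ∧
      (∀ x : N.kerᗮ, V (S x) = N x) ∧ ∀ x, V x ∈ closure (Set.range N) := by
  have hsa : adjoint (CFC.abs N) = CFC.abs N := (CFC.abs_nonneg N).isSelfAdjoint.adjoint_eq
  have hsymm : ∀ x y, ⟪CFC.abs N x, y⟫_ℂ = ⟪x, CFC.abs N y⟫_ℂ := fun x y => by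
    conv_lhs => rw [← hsa, adjoint_inner_left]
  have hnorm : ∀ x, ‖CFC.abs N x‖ = ‖N x‖ := fun x => by
    rw [@norm_eq_sqrt_re_inner ℂ, @norm_eq_sqrt_re_inner ℂ, inner_cfcAbs_apply]
  have hker : ∀ x, CFC.abs N x = 0 ↔ N x = 0 := fun x => by
    rw [← norm_eq_zero, hnorm, norm_eq_zero]
  have hmem : ∀ x, CFC.abs N x ∈ N.kerᗮ := fun x z hz => by
    rw [← hsymm, (hker z).mpr hz, inner_zero_left]
  let Q : E →L[ℂ] N.kerᗮ := (CFC.abs N).codRestrict _ hmem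
  have hdense : DenseRange Q := by
    change Dense (Q.range : Set N.kerᗮ)
    rw [Submodule.dense_iff_topologicalClosure_eq_top, Submodule.topologicalClosure_eq_top_iff,
      Submodule.eq_bot_iff]
    intro x hx
    have hx0 : CFC.abs N (x : E) = 0 := by
      rw [← inner_self_eq_zero (𝕜 := ℂ), ← hsymm]
      exact hx (Q (CFC.abs N x)) ⟨_, rfl⟩
    have := x.2 (x : E) ((hker x).mp hx0)
    exact Subtype.ext (inner_self_eq_zero.mp this)
  have hQ : ∀ x, ‖N x‖ = ‖Q x‖ := fun x => (hnorm x).symm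
  -- `|N| x ↦ N x` is isometric on a dense range, so it extends.
  let V := (N : E →ₗ[ℂ] E).extendOfNorm (Q : E →ₗ[ℂ] N.kerᗮ)
  have hV : ∀ x, V (Q x) = N x := fun x =>
    LinearMap.extendOfNorm_eq (f := (N : E →ₗ[ℂ] E)) (e := (Q : E →ₗ[ℂ] N.kerᗮ)) hdense
      ⟨1, fun x => by simpa using (hQ x).le⟩ x
  have hVn : ∀ x, ‖V x‖ = ‖x‖ := fun x =>
    hdense.induction_on (p := fun x => ‖V x‖ = ‖x‖) x (isClosed_eq (by fun_prop) (by fun_prop))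
      fun y => by rw [hV, hQ]
  refine ⟨Q.comp N.kerᗮ.subtypeL, ⟨V, hVn⟩, ?_, fun x => hV x, fun x => ?_⟩
  · rw [isSelfAdjoint_iff', eq_comm, eq_adjoint_iff]
    exact fun x y => hsymm x y
  · refine hdense.induction_on (p := fun x => V x ∈ closure (Set.range N)) x
      (isClosed_closure.preimage V.continuous) fun y => ?_
    rw [hV]
    exact subset_closure ⟨y, rfl⟩

theorem isComplexSymmetric_of_sq_eq_zero {N : E →L[ℂ] E} (hN : N ^ 2 = 0) :
    IsComplexSymmetric N := by
  classical
  obtain ⟨S, V, hS, hVS, hVmem⟩ := exists_linearIsometry_comp_eq N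
  obtain ⟨ι, b, hb⟩ := hS.exists_hilbertBasis_im_inner_eq_zero
  have hNN : ∀ x, N (N x) = 0 := fun x => by
    rw [← mul_apply_eq_comp, ← pow_two, hN, zero_apply]
  have hNV : ∀ x, N (V x) = 0 := fun x =>
    closure_minimal (t := {y | N y = 0}) (by rintro _ ⟨y, rfl⟩; exact hNN y)
      (isClosed_eq (by fun_prop) continuous_const) (hVmem x)
  have hbV : ∀ (x y : N.kerᗮ), ⟪(x : E), V y⟫_ℂ = 0 := fun x y => by
    rw [← inner_conj_symm, x.2 (V y) (hNV y), map_zero]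
  have hsymm : ∀ i j, ⟪b i, S (b j)⟫_ℂ = ⟪b j, S (b i)⟫_ℂ := fun i j => by
    rw [← Complex.conj_eq_iff_im.mpr (hb i j), inner_conj_symm]
    conv_lhs => rw [← hS.adjoint_eq, adjoint_inner_left]
  -- The two halves are orthogonal since `V` maps into `ker N`; `N` vanishes on the rest of the
  -- space.
  let p : ι ⊕ ι → E := Sum.elim (fun i => (b i : E)) fun i => V (b i)
  obtain ⟨κ, c, -⟩ := exists_hilbertBasis ℂ (Submodule.span ℂ (Set.range p))ᗮ
  have hpc : ∀ i k, ⟪p i, (c k : E)⟫_ℂ = 0 := fun i k =>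
    (c k).2 _ (Submodule.subset_span ⟨i, rfl⟩)
  have hcp : ∀ k i, ⟪(c k : E), p i⟫_ℂ = 0 := fun k i => by
    rw [← inner_conj_symm, hpc, map_zero]
  have hVc : ∀ k (x : N.kerᗮ), ⟪(c k : E), V x⟫_ℂ = 0 := fun k =>
    b.inner_map_eq_zero V.toContinuousLinearMap fun i => hcp k (Sum.inr i)
  have hNc : ∀ k, N (c k) = 0 := fun k => by
    have hk : (c k : E) ∈ N.kerᗮᗮ := fun x hx => by
      have h : ⟪(c k : E), x⟫_ℂ = 0 :=
        b.inner_map_eq_zero N.kerᗮ.subtypeL (fun i => hcp k (Sum.inl i)) ⟨x, hx⟩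
      rw [← inner_conj_symm, h, map_zero]
    rwa [Submodule.orthogonal_orthogonal] at hk
  let q : (ι ⊕ ι) ⊕ κ → E := Sum.elim p fun k => (c k : E)
  have hq : Orthonormal ℂ q := by
    rw [orthonormal_iff_ite]
    have hbo := orthonormal_iff_ite.mp b.orthonormal
    have hco := orthonormal_iff_ite.mp c.orthonormal
    rintro ((i | i) | k) ((j | j) | l)
    · simpa [q, p] using hbo i j
    · simpa [q, p] using hbV _ _
    · simpa [q] using hpc _ _
    · simpa [q, p] using (b j).2 _ (hNV (b i))
    · simpa [q, p] using hbo i j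
    · simpa [q] using hpc _ _
    · simpa [q] using hcp _ _
    · simpa [q] using hcp _ _
    · simpa [q] using hco k l
  let d : HilbertBasis _ ℂ E := HilbertBasis.mkOfOrthogonalEqBot hq (by
    rw [Submodule.eq_bot_iff]
    intro x hx
    have hxp : x ∈ (Submodule.span ℂ (Set.range p))ᗮ :=
      Submodule.orthogonal_le (Submodule.span_mono (by
        rintro _ ⟨i, rfl⟩; exact ⟨Sum.inl i, rfl⟩)) hx
    have : (⟨x, hxp⟩ : (Submodule.span ℂ (Set.range p))ᗮ) = 0 := c.eq_of_inner_eq fun k => by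
      rw [inner_zero_right]
      exact hx _ (Submodule.subset_span ⟨Sum.inr k, rfl⟩)
    exact congr(($this : E)))
  have hd : ⇑d = q := HilbertBasis.coe_mkOfOrthogonalEqBot _ _
  refine isComplexSymmetric_of_hilbertBasis d (Sum.map Sum.swap id) ?_ ?_
  · rintro ((i | i) | k) <;> rfl
  rw [hd]
  rintro ((i | i) | k) ((j | j) | l)
  all_goals simp [q, p, ← hVS, hNV, hNc, hbV, hVc, hsymm]

end SquareZero

theorem mainTheorem1 {H : Type u} [NormedAddCommGroup H] [InnerProductSpace ℂ H]
    [CompleteSpace H] [TopologicalSpace.SeparableSpace H] (T : H →L[ℂ] H) :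
    IsIndestructibleComplexSymmetric.{u, v} T ↔ T ^ 2 = 0 := by
  refine ⟨fun h => h.sq_eq_zero, fun h K _ _ _ _ B => isComplexSymmetric_of_sq_eq_zero ?_⟩
  rw [pow_two, ← hilbertTensorMap_mul, ← pow_two, h, hilbertTensorMap_zero_left]
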